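/- Let $X$ be a complex Banach space, let $B(X)$ be the Banach algebra of bounded linear operators on $X$, and let $\mathcal S\subseteq B(X)$ be an operator band, that is, a non-empty set of idempotent operators closed under multiplication, with $\mathcal S\neq\{0\}$. Let $\mathcal A(\mathcal S)$ be the (not necessarily unital) subalgebra of $B(X)$ generated by $\mathcal S$, let $\mathcal S'=\{T\in B(X): TS=ST \text{ for all } S\in\mathcal S\}$ be the commutant of $\mathcal S$, and let $\mathcal H(\mathcal S)$, the hyperalgebra of $\mathcal S$, be the subalgebra of $B(X)$ generated by $\mathcal S\cup\mathcal S'$. Overlines denote closures in the operator norm. If $K\in\overline{\mathcal A(\mathcal S)}$ is a compact operator, then for every $A\in\overline{\mathcal H(\mathcal S)}$ the commutator $[K,A]=KA-AK$ lies in the Jacobson radical of the algebra $\overline{\mathcal H(\mathcal S)}$; that is, $[K,\overline{\mathcal H(\mathcal S)}]\subseteq \operatorname{rad}\bigl(\overline{\mathcal H(\mathcal S)}\bigr)$. -/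

import Mathlib

/-- An operator band: a (non-empty) multiplicative semigroup of idempotent bounded operators. -/
structure IsOperatorBand {X : Type*} [NormedAddCommGroup X] [NormedSpace ℂ X]
    (S : Set (X →L[ℂ] X)) : Prop where
  nonempty : S.Nonempty
  mul_mem : ∀ {E F : X →L[ℂ] X}, E ∈ S → F ∈ S → E * F ∈ S
  idempotent : ∀ {E : X →L[ℂ] X}, E ∈ S → IsIdempotentElem E

/-- The (not necessarily unital) algebra `A(S)` generated by a set `S` of bounded operators. -/
def generatedAlgebra {X : Type*} [NormedAddCommGroup X] [NormedSpace ℂ X]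
    (S : Set (X →L[ℂ] X)) : NonUnitalSubalgebra ℂ (X →L[ℂ] X) :=
  NonUnitalAlgebra.adjoin ℂ S

/-- The hyperalgebra `H(S)` of `S`: the algebra generated by `S` and its commutant `S'`.
Since the identity operator lies in `S'`, this algebra is unital. -/
def hyperalgebra {X : Type*} [NormedAddCommGroup X] [NormedSpace ℂ X]
    (S : Set (X →L[ℂ] X)) : Subalgebra ℂ (X →L[ℂ] X) :=
  Algebra.adjoin ℂ (S ∪ Set.centralizer S)

/-! Adjoin to a finite set `G` of band elements any operators commuting with `G`. In the resulting
algebra every prime ideal contains `g` or `1 - g`, for each `g` in `G`. Each `g` is therefore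
central modulo every primitive ideal, so its commutators lie in the Jacobson radical. Elements of
`A(S)` and `H(S)` involve only finitely many band elements, hence `B(KA - AK)` is quasinilpotent for
`K` in `A(S)` and `A`, `B` in `H(S)`. For the closures, `B(KA - AK)` is a norm limit of such
quasinilpotents and is compact when `K` is. Its nonzero spectral points are isolated, and the
maximum principle for resolvents rules them out. Quasinilpotency of all these products is the
radical criterion. -/

open Filter Topology

/-! ### Absorption in monoids of idempotents -/

section Band

variable {M : Type*} [Monoid M] {W : Submonoid M}

/-- In a monoid of idempotents, every product absorbs its inner factors. -/
theorem band_absorb (hW : ∀ x ∈ W, x * x = x) {a x b : M} (ha : a ∈ W) (hx : x ∈ W) (hb : b ∈ W) :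
    (a * x * b) * x * (a * x * b) = a * x * b := by
  have hxx := hW x hx
  have hp := hW _ (W.mul_mem ha hx)
  have hf := hW _ (W.mul_mem hx (W.mul_mem (W.mul_mem ha hx) hb))
  have key : a * x * (x * (a * x * b)) = a * x * b := by
    calc a * x * (x * (a * x * b)) = a * (x * x) * a * x * b := by simp only [mul_assoc]
      _ = (a * x) * (a * x) * b := by rw [hxx]; simp only [mul_assoc]
      _ = a * x * b := by rw [hp]
  calc (a * x * b) * x * (a * x * b) = (a * x * b) * (x * (a * x * b)) := by
        simp only [mul_assoc]
    _ = (a * x * (x * (a * x * b))) * (x * (a * x * b)) := by rw [key]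
    _ = a * x * ((x * (a * x * b)) * (x * (a * x * b))) := by simp only [mul_assoc]
    _ = a * x * b := by rw [hf, key]

/-- In a monoid of idempotents, the elements absorbed by `u` are closed under products. -/
theorem band_absorb_mul (hW : ∀ x ∈ W, x * x = x) {u x y : M} (hu : u ∈ W) (hx : x ∈ W)
    (hy : y ∈ W) (hux : u * x * u = u) (huy : u * y * u = u) : u * (x * y) * u = u := by
  have hf := hW _ (W.mul_mem (W.mul_mem hy hu) hx)
  calc u * (x * y) * u = (u * y * u) * (x * y) * (u * x * u) := by rw [hux, huy]
    _ = u * ((y * u * x) * (y * u * x)) * u := by simp only [mul_assoc]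
    _ = (u * y * u) * x * u := by rw [hf]; simp only [mul_assoc]
    _ = u := by rw [huy, hux]

/-- If `u` absorbs `x`, so does every product having `u` as a factor. -/
theorem band_absorb_of_factor (hW : ∀ x ∈ W, x * x = x) {a u b x : M} (ha : a ∈ W) (hu : u ∈ W)
    (hb : b ∈ W) (hx : x ∈ W) (hux : u * x * u = u) :
    (a * u * b) * x * (a * u * b) = a * u * b := by
  have h := band_absorb hW (W.mul_mem ha hu) hx (W.mul_mem hu hb)
  have e : a * u * x * (u * b) = a * u * b := by
    calc a * u * x * (u * b) = a * (u * x * u) * b := by simp only [mul_assoc]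
      _ = a * u * b := by rw [hux]
  rwa [e] at h

end Band

/-! ### Prime ideals and commutators in the finitely generated case -/

section Prime

variable {R : Type*} [Ring R] {G : Set R}

theorem commute_of_mem_closure {c h : R} (hc : ∀ g ∈ G, c * g = g * c)
    (hh : h ∈ Submonoid.closure G) : c * h = h * c := by
  induction hh using Submonoid.closure_induction with
  | mem x hx => exact hc x hx
  | one => simp
  | mul x y _ _ hx hy => rw [← mul_assoc, hx, mul_assoc, hy, mul_assoc]

/-- If a ring is spanned by the products of elements of a finitely generated monoid of idempotents
with elements commuting with it, then every generator is `0` or `1` modulo every prime ideal. -/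
theorem mem_or_one_sub_mem_of_prime (hG : G.Finite)
    (hW : ∀ x ∈ Submonoid.closure G, x * x = x)
    (hR : ∀ r : R, r ∈ AddSubmonoid.closure
      {x | ∃ c, (∀ g ∈ G, c * g = g * c) ∧ ∃ h ∈ Submonoid.closure G, x = c * h})
    (P : Ideal R) [P.IsTwoSided] (h1 : (1 : R) ∉ P)
    (hP : ∀ x y : R, (∀ r, x * r * y ∈ P) → x ∈ P ∨ y ∈ P) {g : R} (hg : g ∈ G) :
    g ∈ P ∨ 1 - g ∈ P := by
  classical
  set W := Submonoid.closure G with hWdef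
  have hGW : ∀ x ∈ G, x ∈ W := fun x hx => Submonoid.subset_closure hx
  let I : R → Finset R := fun w => hG.toFinset.filter fun x => w * x * w = w
  have mem_I : ∀ w x, x ∈ I w ↔ x ∈ G ∧ w * x * w = w := fun w x => by simp [I]
  -- Among words outside `P`, `w` absorbs the most generators; finiteness of `G` bounds the count.
  obtain ⟨w, ⟨hw, hwP⟩, hmax⟩ : ∃ w, (w ∈ W ∧ w ∉ P) ∧
      ∀ v, v ∈ W → v ∉ P → (I v).card ≤ (I w).card := by
    have hbdd : ∃ n, ∀ v, v ∈ W ∧ v ∉ P → (I v).card ≤ n :=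
      ⟨hG.toFinset.card, fun v _ => Finset.card_filter_le _ _⟩
    by_contra! hcon
    have : ∀ n : ℕ, ∃ w, (w ∈ W ∧ w ∉ P) ∧ n ≤ (I w).card := by
      intro n
      induction n with
      | zero => exact ⟨1, ⟨W.one_mem, h1⟩, Nat.zero_le _⟩
      | succ n ih =>
        obtain ⟨w, hw, hn⟩ := ih
        obtain ⟨v, hv, hvP, hlt⟩ := hcon w hw
        exact ⟨v, ⟨hv, hvP⟩, by omega⟩
    obtain ⟨n, hn⟩ := hbdd
    obtain ⟨w, hw, hlt⟩ := this (n + 1)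
    have := hn w hw
    omega
  -- Such a word absorbs `x` and everything `w` absorbs, so outside `P` it would contradict
  -- maximality.
  have kill : ∀ x ∈ G, w * x * w ≠ w → ∀ a ∈ W, ∀ b ∈ W, w * a * x * b * w ∈ P := by
    intro x hx hne a ha b hb
    by_contra hv
    have hvW : w * a * x * b * w ∈ W :=
      W.mul_mem (W.mul_mem (W.mul_mem (W.mul_mem hw ha) (hGW x hx)) hb) hw
    refine absurd (hmax _ hvW hv) (not_le.2 (Finset.card_lt_card ?_))
    refine (Finset.ssubset_iff_of_subset ?_).2 ⟨x, ?_, ?_⟩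
    · intro y hy
      rw [mem_I] at hy ⊢
      refine ⟨hy.1, ?_⟩
      have := band_absorb_of_factor hW W.one_mem hw
        (W.mul_mem ha (W.mul_mem (hGW x hx) (W.mul_mem hb hw))) (hGW y hy.1) hy.2
      simpa only [one_mul, mul_assoc] using this
    · rw [mem_I]
      refine ⟨hx, ?_⟩
      have := band_absorb hW (W.mul_mem hw ha) (hGW x hx) (W.mul_mem hb hw)
      simpa only [mul_assoc] using this
    · rw [mem_I]
      exact fun h => hne h.2
  have dich : ∀ x ∈ W, w * x * w = w ∨ ∀ a ∈ W, ∀ b ∈ W, w * a * x * b * w ∈ P := by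
    intro x hx
    induction hx using Submonoid.closure_induction with
    | mem x hx =>
      by_cases h : w * x * w = w
      · exact .inl h
      · exact .inr (kill x hx h)
    | one => exact .inl (by rw [mul_one, hW w hw])
    | mul x y hx hy ihx ihy =>
      rcases ihx with hx' | hx'
      · rcases ihy with hy' | hy'
        · exact .inl (band_absorb_mul hW hw hx hy hx' hy')
        · refine .inr fun a ha b hb => ?_
          simpa only [mul_assoc] using hy' (a * x) (W.mul_mem ha hx) b hb
      · refine .inr fun a ha b hb => ?_
        simpa only [mul_assoc] using hx' a ha (y * b) (W.mul_mem hy hb)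
  -- Coefficients commuting with `G` move to the front, giving `w R d R w ⊆ P`; primeness, used
  -- twice with `w ∉ P`, leaves `d ∈ P`.
  have descend : ∀ d : R, (∀ c : R, (∀ g ∈ G, c * g = g * c) → c * d = d * c) →
      (∀ h ∈ W, ∀ h' ∈ W, w * h * d * h' * w ∈ P) → d ∈ P := by
    intro d hcd hd
    have step : ∀ r r' : R, w * r * (d * r' * w) ∈ P := by
      intro r r'
      induction hR r using AddSubmonoid.closure_induction with
      | zero => simp
      | add x y _ _ hx hy => rw [mul_add, add_mul]; exact P.add_mem hx hy
      | mem x hx =>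
        obtain ⟨c, hc, h, hh, rfl⟩ := hx
        induction hR r' using AddSubmonoid.closure_induction with
        | zero => simp
        | add x y _ _ hx hy =>
          rw [mul_add, add_mul, mul_add]; exact P.add_mem hx hy
        | mem x hx =>
          obtain ⟨c', hc', h', hh', rfl⟩ := hx
          have e : w * (c * h) * (d * (c' * h') * w) = (c * c') * (w * h * d * h' * w) := by
            have e1 : w * c = c * w := (commute_of_mem_closure hc hw).symm
            have e2 : w * h * d * c' = c' * (w * h * d) := by
              have a1 := commute_of_mem_closure hc' hw
              have a2 := commute_of_mem_closure hc' hh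
              rw [mul_assoc, ← hcd c' hc', ← mul_assoc, mul_assoc w h c', ← a2, ← mul_assoc,
                ← a1]
              simp only [mul_assoc]
            calc w * (c * h) * (d * (c' * h') * w)
                = (w * c) * (h * d * c' * h' * w) := by simp only [mul_assoc]
              _ = c * (w * h * d * c') * (h' * w) := by rw [e1]; simp only [mul_assoc]
              _ = _ := by rw [e2]; simp only [mul_assoc]
          rw [e]
          exact P.mul_mem_left _ (hd h hh h' hh')
    have s1 : ∀ r', d * r' * w ∈ P := fun r' =>
      (hP w (d * r' * w) fun r => step r r').resolve_left hwP
    exact (hP d w s1).resolve_right hwP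
  by_cases hgw : w * g * w = w
  · right
    refine descend _ (fun c hc => by rw [mul_sub, sub_mul, hc g hg, mul_one, one_mul]) ?_
    intro h hh h' hh'
    have e : w * h * (1 - g) * h' * w = w * h * 1 * h' * w - w * h * g * h' * w := by noncomm_ring
    rw [e]
    -- If `w` absorbs `h` and `h'`, both terms equal `w` and cancel; otherwise each term lies in
    -- `P`.
    rcases dich h hh with h1 | h1
    · rcases dich h' hh' with h2 | h2
      · have e1 := band_absorb_mul hW hw hh hh' h1 h2
        have e2 := band_absorb_mul hW hw hh (W.mul_mem (hGW g hg) hh') h1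
          (band_absorb_mul hW hw (hGW g hg) hh' hgw h2)
        have : w * h * 1 * h' * w - w * h * g * h' * w = 0 := by
          rw [sub_eq_zero]
          simp only [mul_assoc, one_mul] at e1 e2 ⊢
          rw [e1, e2]
        rw [this]; exact P.zero_mem
      · refine P.sub_mem ?_ ?_
        · simpa only [mul_assoc, one_mul] using h2 h hh 1 W.one_mem
        · simpa only [mul_assoc, one_mul] using h2 (h * g) (W.mul_mem hh (hGW g hg)) 1 W.one_mem
    · refine P.sub_mem ?_ ?_
      · simpa only [mul_assoc, one_mul] using h1 1 W.one_mem h' hh'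
      · simpa only [mul_assoc, one_mul] using h1 1 W.one_mem (g * h') (W.mul_mem (hGW g hg) hh')
  · left
    refine descend g (fun c hc => hc g hg) fun h hh h' hh' => ?_
    exact kill g hg hgw h hh h' hh'

theorem commutator_mem_jacobson_of_span (hG : G.Finite)
    (hW : ∀ x ∈ Submonoid.closure G, x * x = x)
    (hR : ∀ r : R, r ∈ AddSubmonoid.closure
      {x | ∃ c, (∀ g ∈ G, c * g = g * c) ∧ ∃ h ∈ Submonoid.closure G, x = c * h})
    {g : R} (hg : g ∈ G) (r : R) : g * r - r * g ∈ Ring.jacobson R := by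
  rw [Ring.jacobson_eq_sInf_isMaximal, Ideal.mem_sInf]
  intro M hM
  replace hM : M.IsMaximal := hM
  -- The annihilator of the simple module `R ⧸ M`: a prime two-sided ideal contained in `M`.
  let P : Ideal R :=
    { carrier := {x | ∀ t, x * t ∈ M}
      add_mem' := fun ha hb t => by rw [add_mul]; exact M.add_mem (ha t) (hb t)
      zero_mem' := fun t => by simp
      smul_mem' := fun c x hx t => by
        rw [smul_eq_mul, mul_assoc]; exact M.mul_mem_left _ (hx t) }
  have memP : ∀ x, x ∈ P ↔ ∀ t, x * t ∈ M := fun x => Iff.rfl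
  have : P.IsTwoSided := ⟨fun {a} b ha t => by rw [mul_assoc]; exact ha (b * t)⟩
  have h1 : (1 : R) ∉ P := fun h => hM.ne_top ((Ideal.eq_top_iff_one M).2 (by simpa using h 1))
  have hP : ∀ x y : R, (∀ r, x * r * y ∈ P) → x ∈ P ∨ y ∈ P := by
    intro x y h
    by_contra! hxy
    obtain ⟨hx, hy⟩ := hxy
    rw [memP] at hx hy
    push Not at hx hy
    obtain ⟨s, hs⟩ := hx
    obtain ⟨t, ht⟩ := hy
    obtain ⟨z, hz⟩ := hM.exists_inv ht
    obtain ⟨m, hm, hzm⟩ := hz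
    apply hs
    have e : x * s = x * (s * z) * y * t + (x * s) * m := by
      calc x * s = x * s * (z * (y * t) + m) := by rw [hzm, mul_one]
        _ = _ := by noncomm_ring
    rw [e]
    exact M.add_mem (h (s * z) t) (M.mul_mem_left _ hm)
  have key : g * r - r * g ∈ P := by
    rcases mem_or_one_sub_mem_of_prime hG hW hR P h1 hP hg with h | h
    · exact P.sub_mem (P.mul_mem_right _ h) (P.mul_mem_left _ h)
    · have e : g * r - r * g = r * (1 - g) - (1 - g) * r := by noncomm_ring
      rw [e]
      exact P.sub_mem (P.mul_mem_left _ h) (P.mul_mem_right _ h)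
  simpa using key 1

end Prime

theorem isUnit_one_add_of_mem_jacobson {R : Type*} [Ring R] {x : R} (hx : x ∈ Ring.jacobson R) :
    IsUnit (1 + x) := by
  have left : ∀ y ∈ Ring.jacobson R, ∃ z, z * (1 + y) = 1 := by
    intro y hy
    rw [← Ideal.jacobson_bot, Ideal.mem_jacobson_iff] at hy
    obtain ⟨z, hz⟩ := hy 1
    refine ⟨z, ?_⟩
    rw [Ideal.mem_bot] at hz
    rw [← sub_eq_zero, ← hz]
    noncomm_ring
  obtain ⟨z, hz⟩ := left x hx
  obtain ⟨u, hu⟩ := left (-(z * x)) (neg_mem (Ideal.mul_mem_left _ _ hx))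
  have e : 1 + -(z * x) = z := by rw [← hz]; noncomm_ring
  rw [e] at hu
  have hux : u = 1 + x := by
    calc u = u * (z * (1 + x)) := by rw [hz, mul_one]
      _ = 1 + x := by rw [← mul_assoc, hu, one_mul]
  exact ⟨⟨1 + x, z, by rw [← hux, hu], hz⟩, rfl⟩

/-! ### Spectra of compact operators and limits of quasinilpotents -/

section CompactSpectrum

open Module Module.End

/-- The spectrum of a compact operator has only finitely many points outside any ball around `0`. -/
theorem IsCompactOperator.finite_spectrum_norm_ge {𝕜 X : Type*} [RCLike 𝕜]
    [NormedAddCommGroup X] [NormedSpace 𝕜 X] [CompleteSpace X] {T : X →L[𝕜] X}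
    (hT : IsCompactOperator T) {ε : ℝ} (hε : 0 < ε) :
    {μ | μ ∈ spectrum 𝕜 T ∧ ε ≤ ‖μ‖}.Finite := by
  by_contra hinf
  let μ : ℕ → 𝕜 := fun n => (Set.Infinite.natEmbedding _ hinf n : 𝕜)
  have hμinj : Function.Injective μ :=
    Subtype.val_injective.comp (Set.Infinite.natEmbedding _ hinf).injective
  have hμ : ∀ n, μ n ∈ spectrum 𝕜 T ∧ ε ≤ ‖μ n‖ := fun n =>
    (Set.Infinite.natEmbedding _ hinf n).2
  have hμ0 : ∀ n, μ n ≠ 0 := fun n h => by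
    have := (hμ n).2
    rw [h, norm_zero] at this
    linarith
  have hev : ∀ n, ∃ v, HasEigenvector (T : End 𝕜 X) (μ n) v := fun n =>
    ((hT.hasEigenvalue_iff_mem_spectrum (hμ0 n)).2 (hμ n).1).exists_hasEigenvector
  choose v hv using hev
  have hTv : ∀ n, T (v n) = μ n • v n := fun n => (hv n).apply_eq_smul
  have hli : LinearIndependent 𝕜 v := eigenvectors_linearIndependent' _ μ hμinj v hv
  let V : ℕ → Submodule 𝕜 X := fun n => Submodule.span 𝕜 (v '' Set.Iio n)
  have hVmono : Monotone V := fun m n h =>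
    Submodule.span_mono (Set.image_mono (Set.Iio_subset_Iio h))
  have hVfin : ∀ n, FiniteDimensional 𝕜 (V n) := fun n =>
    FiniteDimensional.span_of_finite 𝕜 ((Set.finite_Iio n).image v)
  have hVT : ∀ n, ∀ x ∈ V n, T x ∈ V n := by
    intro n x hx
    induction hx using Submodule.span_induction with
    | mem x hx =>
      obtain ⟨i, hi, rfl⟩ := hx
      rw [hTv]
      exact Submodule.smul_mem _ _ (Submodule.subset_span ⟨i, hi, rfl⟩)
    | zero => simp
    | add x y _ _ hx hy => rw [map_add]; exact Submodule.add_mem _ hx hy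
    | smul a x _ hx => rw [map_smul]; exact Submodule.smul_mem _ _ hx
  have hVsub : ∀ n, ∀ x ∈ V (n + 1), T x - μ n • x ∈ V n := by
    intro n x hx
    induction hx using Submodule.span_induction with
    | mem x hx =>
      obtain ⟨i, hi, rfl⟩ := hx
      rw [hTv, ← sub_smul]
      rcases (Nat.lt_succ_iff.1 hi).eq_or_lt with h | h
      · simp [h]
      · exact Submodule.smul_mem _ _ (Submodule.subset_span ⟨i, h, rfl⟩)
    | zero => simp
    | add x y _ _ hx hy =>
      rw [map_add, smul_add, add_sub_add_comm]; exact Submodule.add_mem _ hx hy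
    | smul a x _ hx =>
      rw [map_smul, smul_comm, ← smul_sub]; exact Submodule.smul_mem _ _ hx
  obtain ⟨c, hc⟩ := NormedField.exists_one_lt_norm 𝕜
  have hseq : ∀ n, ∃ x ∈ V (n + 1), ‖x‖ ≤ ‖c‖ + 1 ∧ ∀ y ∈ V n, 1 ≤ ‖x - y‖ := by
    intro n
    have hcl : IsClosed ((V n).comap (V (n + 1)).subtype : Set (V (n + 1))) :=
      Submodule.closed_of_finiteDimensional _
    have hvn : v n ∈ V (n + 1) := Submodule.subset_span ⟨n, Nat.lt_succ_self n, rfl⟩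
    have hne : ∃ x : V (n + 1), x ∉ (V n).comap (V (n + 1)).subtype :=
      ⟨⟨v n, hvn⟩, by simpa using! hli.notMem_span_image (s := Set.Iio n) (x := n) (by simp)⟩
    obtain ⟨⟨x, hx⟩, hxn, hxy⟩ := riesz_lemma_of_norm_lt hc (lt_add_one ‖c‖) hcl hne
    simp only [Submodule.mem_comap, Submodule.subtype_apply, Subtype.forall] at hxy
    exact ⟨x, hx, hxn, fun y hy => hxy y (hVmono n.le_succ hy) hy⟩
  choose f hfV hfn hf using hseq
  have hsep : Pairwise fun m n => ε ≤ ‖T (f m) - T (f n)‖ := by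
    have : Std.Symm fun m n => ε ≤ ‖T (f m) - T (f n)‖ :=
      ⟨fun m n h => by rwa [norm_sub_rev]⟩
    apply Pairwise.of_lt
    intro m n hmn
    -- Modulo `V n`, `T` multiplies `f n` by `μ n`, so the Riesz distance 1 becomes at least `ε`.
    have hu : T (f m) - (T (f n) - μ n • f n) ∈ V n :=
      Submodule.sub_mem _ (hVT n _ (hVmono hmn (hfV m))) (hVsub n _ (hfV n))
    have e : T (f m) - T (f n) =
        -(μ n • (f n - (μ n)⁻¹ • (T (f m) - (T (f n) - μ n • f n)))) := by
      rw [smul_sub, smul_inv_smul₀ (hμ0 n)]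
      abel
    rw [e, norm_neg, norm_smul]
    calc ε ≤ ‖μ n‖ * 1 := by rw [mul_one]; exact (hμ n).2
      _ ≤ _ := by gcongr; exact hf n _ (Submodule.smul_mem _ _ hu)
  obtain ⟨K, hK, hK'⟩ := hT.image_closedBall_subset_compact (‖c‖ + 1)
  obtain ⟨y, -, ψ, hψ, hψy⟩ := hK.tendsto_subseq (fun n => hK' ⟨f n, by simpa using hfn n, rfl⟩)
  obtain ⟨N, hN⟩ := Metric.cauchySeq_iff'.1 hψy.cauchySeq ε hε
  have : ‖T (f (ψ (N + 1))) - T (f (ψ N))‖ < ε := by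
    simpa [dist_eq_norm_sub] using hN (N + 1)
  exact this.not_ge (hsep (by simp [hψ.injective.eq_iff]))

/-- The resolvent of an element with spectrum in `{0}` obeys the maximum principle on discs avoiding
the origin. -/
theorem norm_resolvent_le_of_sphere {A : Type*} [NormedRing A] [NormedAlgebra ℂ A]
    [CompleteSpace A] {a : A} (ha : spectrum ℂ a ⊆ {0}) {z : ℂ} {r C : ℝ} (hr : 0 < r)
    (hrz : r < ‖z‖) (hC : ∀ w ∈ Metric.sphere z r, ‖resolvent a w‖ ≤ C) : ‖resolvent a z‖ ≤ C := by
  have hres : ∀ w ∈ Metric.closedBall z r, w ∈ resolventSet ℂ a := by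
    intro w hw
    by_contra h
    have h0 : w = 0 := ha h
    rw [h0, Metric.mem_closedBall, dist_zero_left] at hw
    linarith
  have hd : DifferentiableOn ℂ (resolvent a) (Metric.closedBall z r) := fun w hw =>
    (spectrum.hasDerivAt_resolvent_const_left (hres w hw)).differentiableAt.differentiableWithinAt
  refine Complex.norm_le_of_forall_mem_frontier_norm_le (U := Metric.ball z r)
    Metric.isBounded_ball (hd.diffContOnCl_ball subset_rfl) ?_
    (subset_closure (Metric.mem_ball_self hr))
  rwa [frontier_ball z hr.ne']

/-- A nonzero point of the spectrum that is encircled by the resolvent set cannot appear in a limit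
of elements with spectrum in `{0}`. -/
theorem mem_resolventSet_of_tendsto {A : Type*} [NormedRing A] [NormedAlgebra ℂ A]
    [CompleteSpace A] {a : ℕ → A} {b : A} (ha : ∀ n, spectrum ℂ (a n) ⊆ {0})
    (hab : Tendsto a atTop (𝓝 b)) {z : ℂ} {r : ℝ} (hr : 0 < r) (hrz : r < ‖z‖)
    (hb : ∀ w ∈ Metric.sphere z r, w ∈ resolventSet ℂ b) : z ∈ resolventSet ℂ b := by
  have hcont : ∀ w ∈ Metric.sphere z r,
      ContinuousAt (fun p : A × ℂ => Ring.inverse (algebraMap ℂ A p.2 - p.1)) (b, w) := by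
    intro w hw
    obtain ⟨u, hu⟩ := hb w hw
    have h1 : ContinuousAt Ring.inverse (algebraMap ℂ A w - b) := by
      rw [← hu]; exact NormedRing.inverse_continuousAt u
    have h2 : ContinuousAt (fun p : A × ℂ => algebraMap ℂ A p.2 - p.1) (b, w) :=
      (((continuous_algebraMap ℂ A).comp continuous_snd).sub continuous_fst).continuousAt
    exact ContinuousAt.comp (f := fun p : A × ℂ => algebraMap ℂ A p.2 - p.1) h1 h2
  -- A uniform bound for the resolvents on the circle, for elements close to `b`
  obtain ⟨C, hC⟩ : ∃ C : ℝ, ∀ᶠ x in 𝓝 b, ∀ w ∈ Metric.sphere z r, ‖resolvent x w‖ ≤ C := by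
    have hcpt : IsCompact (Metric.sphere z r) := isCompact_sphere z r
    have hbd : ∃ C : ℝ, ∀ w ∈ Metric.sphere z r, ‖resolvent b w‖ ≤ C := by
      refine hcpt.exists_bound_of_continuousOn fun w hw => ContinuousAt.continuousWithinAt ?_
      exact (spectrum.hasDerivAt_resolvent_const_left (hb w hw)).continuousAt
    obtain ⟨C, hC⟩ := hbd
    refine ⟨C + 1, ?_⟩
    have hev : ∀ w ∈ Metric.sphere z r, ∀ᶠ p : A × ℂ in 𝓝 b ×ˢ 𝓝 w,
        ‖resolvent p.1 p.2‖ ≤ C + 1 := by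
      intro w hw
      rw [← nhds_prod_eq]
      have hlt : ‖Ring.inverse (algebraMap ℂ A w - b)‖ < C + 1 := by
        have := hC w hw
        unfold resolvent at this
        linarith
      exact ((hcont w hw).norm.eventually_lt continuousAt_const hlt).mono fun p hp => hp.le
    exact hcpt.eventually_forall_of_forall_eventually fun w hw => by
      rw [nhds_prod_eq]; exact hev w hw
  have hCn : ∀ᶠ n in atTop, ‖resolvent (a n) z‖ ≤ C := (hab.eventually hC).mono fun n hn =>
    norm_resolvent_le_of_sphere (ha n) hr hrz hn
  have hz0 : z ≠ 0 := norm_pos_iff.1 (hr.trans hrz)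
  have hC0 : 0 < |C| + 1 := by positivity
  have hsmall : ∀ᶠ n in atTop, ‖a n - b‖ < (|C| + 1)⁻¹ := by
    have h := (tendsto_iff_norm_sub_tendsto_zero.1 hab)
    exact h.eventually_lt_const (inv_pos.2 hC0)
  obtain ⟨n, h1, h2⟩ := (hCn.and hsmall).exists
  have hzn : z ∈ resolventSet ℂ (a n) := by
    by_contra h
    exact hz0 (ha n h)
  have hun : IsUnit (algebraMap ℂ A z - a n) := hzn
  have hlt : ‖Ring.inverse (algebraMap ℂ A z - a n) * (b - a n)‖ < 1 := by
    calc _ ≤ ‖resolvent (a n) z‖ * ‖b - a n‖ := norm_mul_le _ _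
      _ ≤ (|C| + 1) * ‖a n - b‖ := by
        rw [norm_sub_rev]
        gcongr
        linarith [le_abs_self C]
      _ < (|C| + 1) * (|C| + 1)⁻¹ := by gcongr
      _ = 1 := mul_inv_cancel₀ hC0.ne'
  have hprod := hun.mul (isUnit_one_sub_of_norm_lt_one hlt)
  -- The resolvent bound at `z` makes `z - b` a small perturbation of the invertible `z - a n`.
  have e : (algebraMap ℂ A z - a n) *
      (1 - Ring.inverse (algebraMap ℂ A z - a n) * (b - a n)) = algebraMap ℂ A z - b := by
    rw [mul_sub, mul_one, Ring.mul_inverse_cancel_left _ _ hun]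
    abel
  rw [e] at hprod
  exact hprod

/-- A compact operator that is a norm limit of operators with spectrum in `{0}` has spectrum
in `{0}`. -/
theorem IsCompactOperator.spectrum_subset_zero_of_tendsto {X : Type*} [NormedAddCommGroup X]
    [NormedSpace ℂ X] [CompleteSpace X] {T : X →L[ℂ] X} (hT : IsCompactOperator T)
    {a : ℕ → X →L[ℂ] X} (ha : ∀ n, spectrum ℂ (a n) ⊆ {0}) (haT : Tendsto a atTop (𝓝 T)) :
    spectrum ℂ T ⊆ {0} := by
  intro z hz
  by_contra hz0
  have hzpos : 0 < ‖z‖ := norm_pos_iff.2 hz0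
  have hfin := hT.finite_spectrum_norm_ge (half_pos hzpos)
  -- A circle of radius below `‖z‖ / 2` stays where only finitely many spectral points lie, so a
  -- generic radius misses them all.
  obtain ⟨r, ⟨hr0, hr1⟩, hr⟩ : ∃ r ∈ Set.Ioo 0 (‖z‖ / 2),
      r ∉ (fun w => dist w z) '' {μ | μ ∈ spectrum ℂ T ∧ ‖z‖ / 2 ≤ ‖μ‖} :=
    (Set.Ioo_infinite (half_pos hzpos)).exists_notMem_finite (hfin.image _)
  refine hz (mem_resolventSet_of_tendsto ha haT hr0 (by linarith) fun w hw => ?_)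
  by_contra hwT
  refine hr ⟨w, ⟨hwT, ?_⟩, hw⟩
  have : ‖z‖ ≤ ‖w‖ + dist w z := by
    rw [dist_comm, dist_eq_norm]
    have := norm_add_le w (z - w)
    rwa [add_sub_cancel] at this
  rw [Metric.mem_sphere] at hw
  linarith

end CompactSpectrum

/-! ### Algebras generated by a finite set and part of its commutant -/

theorem AddSubmonoid.mul_mem_closure_of_mul_mem {R : Type*} [NonUnitalNonAssocSemiring R]
    {Z : Set R} (hZ : ∀ x ∈ Z, ∀ y ∈ Z, x * y ∈ Z) {x y : R} (hx : x ∈ AddSubmonoid.closure Z)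
    (hy : y ∈ AddSubmonoid.closure Z) : x * y ∈ AddSubmonoid.closure Z := by
  induction hx using AddSubmonoid.closure_induction with
  | zero => simp
  | add a b _ _ ha hb => rw [add_mul]; exact add_mem ha hb
  | mem a ha =>
    induction hy using AddSubmonoid.closure_induction with
    | zero => simp
    | add c d _ _ hc hd => rw [mul_add]; exact add_mem hc hd
    | mem c hc => exact AddSubmonoid.subset_closure (hZ a ha c hc)

section Adjoin

variable {k B : Type*} [CommRing k] [Ring B] [Algebra k B] {G C : Set B}

theorem commutator_generator_mem_jacobson (hG : G.Finite) (hC : C ⊆ Set.centralizer G)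
    (hW : ∀ x ∈ Submonoid.closure G, x * x = x) {g : Algebra.adjoin k (G ∪ C)} (hg : (g : B) ∈ G)
    (r : Algebra.adjoin k (G ∪ C)) : g * r - r * g ∈ Ring.jacobson (Algebra.adjoin k (G ∪ C)) := by
  let R := Algebra.adjoin k (G ∪ C)
  let G' : Set R := {g | (g : B) ∈ G}
  have hG' : G'.Finite := hG.preimage Subtype.val_injective.injOn
  have hW' : ∀ x ∈ Submonoid.closure G', x * x = x := by
    intro x hx
    have : (x : B) ∈ Submonoid.closure G := by
      induction hx using Submonoid.closure_induction with
      | mem x hx => exact Submonoid.subset_closure hx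
      | one => exact one_mem _
      | mul x y _ _ hx hy => exact mul_mem hx hy
    exact Subtype.ext (hW _ this)
  let Z : Set R := {x | ∃ c, (∀ g ∈ G', c * g = g * c) ∧ ∃ h ∈ Submonoid.closure G', x = c * h}
  have hZ : ∀ x ∈ Z, ∀ y ∈ Z, x * y ∈ Z := by
    rintro _ ⟨c, hc, h, hh, rfl⟩ _ ⟨c', hc', h', hh', rfl⟩
    refine ⟨c * c', fun g hg => ?_, h * h', mul_mem hh hh', ?_⟩
    · rw [mul_assoc, hc' g hg, ← mul_assoc, hc g hg, mul_assoc]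
    · rw [mul_assoc, ← mul_assoc h, ← commute_of_mem_closure hc' hh]
      simp only [mul_assoc]
  have hR : ∀ r : R, r ∈ AddSubmonoid.closure Z := by
    rintro ⟨r, hr⟩
    induction hr using Algebra.adjoin_induction with
    | mem x hx₀ =>
      refine AddSubmonoid.subset_closure ?_
      rcases id hx₀ with hx' | hx'
      · exact ⟨1, fun g _ => by rw [one_mul, mul_one], ⟨x, Algebra.subset_adjoin hx₀⟩,
          Submonoid.subset_closure hx', (one_mul _).symm⟩
      · exact ⟨⟨x, Algebra.subset_adjoin hx₀⟩, fun g hg => Subtype.ext (hC hx' g hg).symm,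
          1, one_mem _, (mul_one _).symm⟩
    | algebraMap a =>
      refine AddSubmonoid.subset_closure ⟨algebraMap k R a, fun g _ => Algebra.commutes a g,
        1, one_mem _, ?_⟩
      rw [mul_one]
      rfl
    | add x y hx hy h1 h2 => exact add_mem h1 h2
    | mul x y hx hy h1 h2 => exact AddSubmonoid.mul_mem_closure_of_mul_mem hZ h1 h2
  exact commutator_mem_jacobson_of_span hG' hW' hR hg r

/-- The radical is a two-sided ideal and `[yz, r] = y[z, r] + [y, r]z`, so the claim passes from
generators to products. -/
theorem commutator_mem_jacobson_adjoin (hG : G.Finite) (hC : C ⊆ Set.centralizer G)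
    (hW : ∀ x ∈ Submonoid.closure G, x * x = x) {x : B} (hx : x ∈ NonUnitalAlgebra.adjoin k G)
    (hxR : x ∈ Algebra.adjoin k (G ∪ C)) (r : Algebra.adjoin k (G ∪ C)) :
    ⟨x, hxR⟩ * r - r * ⟨x, hxR⟩ ∈ Ring.jacobson (Algebra.adjoin k (G ∪ C)) := by
  have hsub : ∀ y ∈ NonUnitalAlgebra.adjoin k G, y ∈ Algebra.adjoin k (G ∪ C) := by
    intro y hy
    induction hy using NonUnitalAlgebra.adjoin_induction with
    | mem y hy => exact Algebra.subset_adjoin (.inl hy)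
    | add y z _ _ hy hz => exact add_mem hy hz
    | zero => exact zero_mem _
    | mul y z _ _ hy hz => exact mul_mem hy hz
    | smul a y _ hy => exact Subalgebra.smul_mem _ hy a
  induction hx using NonUnitalAlgebra.adjoin_induction with
  | mem y hy => exact commutator_generator_mem_jacobson hG hC hW hy r
  | add y z hy hz h1 h2 =>
    have := add_mem (h1 (hsub y hy)) (h2 (hsub z hz))
    convert this using 1
    ext
    simp only [Subalgebra.coe_add, Subalgebra.coe_mul, AddSubgroupClass.coe_sub]
    noncomm_ring
  | zero =>
    convert zero_mem (Ring.jacobson (Algebra.adjoin k (G ∪ C))) using 1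
    ext
    simp
  | mul y z hy hz h1 h2 =>
    have := add_mem (Ideal.mul_mem_left _ ⟨y, hsub y hy⟩ (h2 (hsub z hz)))
      (Ideal.mul_mem_right (⟨z, hsub z hz⟩ : Algebra.adjoin k (G ∪ C)) _ (h1 (hsub y hy)))
    convert this using 1
    ext
    simp only [Subalgebra.coe_add, Subalgebra.coe_mul, AddSubgroupClass.coe_sub]
    noncomm_ring
  | smul a y hy h1 =>
    have := Submodule.smul_of_tower_mem (Ring.jacobson (Algebra.adjoin k (G ∪ C))) a
      (h1 (hsub y hy))
    convert this using 1
    ext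
    simp [smul_sub]

/-- Only `S` is cut down to a finite set, as the maximality argument requires; `C` is kept whole. -/
theorem exists_finite_mem_adjoin_union {S : Set B} {x : B} (hx : x ∈ Algebra.adjoin k (S ∪ C)) :
    ∃ F ⊆ S, F.Finite ∧ x ∈ Algebra.adjoin k (F ∪ C) := by
  have mono : ∀ {F F' : Set B}, F ⊆ F' → Algebra.adjoin k (F ∪ C) ≤ Algebra.adjoin k (F' ∪ C) :=
    fun h => Algebra.adjoin_mono (Set.union_subset_union_left _ h)
  induction hx using Algebra.adjoin_induction with
  | mem x hx =>
    rcases hx with hx | hx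
    · exact ⟨{x}, by simpa using hx, Set.finite_singleton x, Algebra.subset_adjoin (.inl rfl)⟩
    · exact ⟨∅, by simp, Set.finite_empty, Algebra.subset_adjoin (.inr hx)⟩
  | algebraMap a => exact ⟨∅, by simp, Set.finite_empty, Subalgebra.algebraMap_mem _ a⟩
  | add x y _ _ hx hy =>
    obtain ⟨F, hF, hFf, h⟩ := hx
    obtain ⟨F', hF', hFf', h'⟩ := hy
    exact ⟨F ∪ F', Set.union_subset hF hF', hFf.union hFf',
      add_mem (mono Set.subset_union_left h) (mono Set.subset_union_right h')⟩
  | mul x y _ _ hx hy =>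
    obtain ⟨F, hF, hFf, h⟩ := hx
    obtain ⟨F', hF', hFf', h'⟩ := hy
    exact ⟨F ∪ F', Set.union_subset hF hF', hFf.union hFf',
      mul_mem (mono Set.subset_union_left h) (mono Set.subset_union_right h')⟩

theorem exists_finite_mem_nonUnital_adjoin {S : Set B} {x : B}
    (hx : x ∈ NonUnitalAlgebra.adjoin k S) :
    ∃ F ⊆ S, F.Finite ∧ x ∈ NonUnitalAlgebra.adjoin k F := by
  induction hx using NonUnitalAlgebra.adjoin_induction with
  | mem x hx =>
    exact ⟨{x}, by simpa using hx, Set.finite_singleton x, NonUnitalAlgebra.subset_adjoin k rfl⟩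
  | zero => exact ⟨∅, by simp, Set.finite_empty, zero_mem _⟩
  | add x y _ _ hx hy =>
    obtain ⟨F, hF, hFf, h⟩ := hx
    obtain ⟨F', hF', hFf', h'⟩ := hy
    exact ⟨F ∪ F', Set.union_subset hF hF', hFf.union hFf',
      add_mem (NonUnitalAlgebra.adjoin_mono Set.subset_union_left h)
        (NonUnitalAlgebra.adjoin_mono Set.subset_union_right h')⟩
  | mul x y _ _ hx hy =>
    obtain ⟨F, hF, hFf, h⟩ := hx
    obtain ⟨F', hF', hFf', h'⟩ := hy
    exact ⟨F ∪ F', Set.union_subset hF hF', hFf.union hFf',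
      mul_mem (NonUnitalAlgebra.adjoin_mono Set.subset_union_left h)
        (NonUnitalAlgebra.adjoin_mono Set.subset_union_right h')⟩
  | smul a x _ hx =>
    obtain ⟨F, hF, hFf, h⟩ := hx
    exact ⟨F, hF, hFf, SMulMemClass.smul_mem a h⟩

theorem nonUnital_adjoin_subset_adjoin_union {x : B} (hx : x ∈ NonUnitalAlgebra.adjoin k G) :
    x ∈ Algebra.adjoin k (G ∪ C) :=
  NonUnitalAlgebra.adjoin_le_algebra_adjoin k _
    (NonUnitalAlgebra.adjoin_mono Set.subset_union_left hx)

end Adjoin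

/-! ### The Jacobson radical and quasinilpotency -/

theorem spectrum_subset_zero_of_mem_jacobson {k B : Type*} [Field k] [Ring B] [Algebra k B]
    {R : Subalgebra k B} {y : R} (hy : y ∈ Ring.jacobson R) : spectrum k (y : B) ⊆ {0} := by
  intro z hz
  by_contra hz0
  replace hz0 : z ≠ 0 := hz0
  apply hz
  have hu : IsUnit (1 + -(z⁻¹ • y)) :=
    isUnit_one_add_of_mem_jacobson (neg_mem (Submodule.smul_of_tower_mem _ _ hy))
  have hz' : IsUnit (algebraMap k R z) := (IsUnit.mk0 z hz0).map (algebraMap k R)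
  have h := (hz'.mul hu).map R.val
  have e : R.val (algebraMap k R z * (1 + -(z⁻¹ • y))) = algebraMap k B z - y := by
    rw [← Algebra.smul_def, smul_add, smul_neg, smul_inv_smul₀ hz0, ← Algebra.algebraMap_eq_smul_one]
    simp [sub_eq_add_neg]
  rwa [e] at h

theorem mem_jacobson_of_forall_spectrum_subset_zero {A : Type*} [Ring A] [Algebra ℂ A] {x : A}
    (h : ∀ y, spectrum ℂ (y * x) ⊆ {0}) : x ∈ Ring.jacobson A := by
  rw [← Ideal.jacobson_bot, Ideal.mem_jacobson_iff]
  intro y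
  have hu : IsUnit (algebraMap ℂ A (-1) - y * x) := by
    by_contra hn
    have := h y hn
    simp at this
  obtain ⟨z, hz⟩ := hu.exists_left_inv
  refine ⟨-z, ?_⟩
  rw [Ideal.mem_bot, ← sub_eq_zero.2 hz, map_neg, map_one]
  noncomm_ring

theorem spectrum_mul_commutator_subset_zero {k B : Type*} [Field k] [Ring B] [Algebra k B]
    {G C : Set B} (hG : G.Finite) (hC : C ⊆ Set.centralizer G)
    (hW : ∀ x ∈ Submonoid.closure G, x * x = x) {x a b : B} (hx : x ∈ NonUnitalAlgebra.adjoin k G)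
    (ha : a ∈ Algebra.adjoin k (G ∪ C)) (hb : b ∈ Algebra.adjoin k (G ∪ C)) :
    spectrum k (b * (x * a - a * x)) ⊆ {0} := by
  have h := Ideal.mul_mem_left _ ⟨b, hb⟩ (commutator_mem_jacobson_adjoin hG hC hW hx
    (nonUnital_adjoin_subset_adjoin_union hx) ⟨a, ha⟩)
  exact spectrum_subset_zero_of_mem_jacobson h

/-- Quasinilpotency may be tested in the ambient Banach algebra. -/
theorem mem_jacobson_of_isClosed {A : Type*} [NormedRing A] [NormedAlgebra ℂ A] [CompleteSpace A]
    {R : Subalgebra ℂ A} (hR : IsClosed (R : Set A)) {x : A} (hx : x ∈ R)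
    (h : ∀ y ∈ R, spectrum ℂ (y * x) ⊆ {0}) : (⟨x, hx⟩ : R) ∈ Ring.jacobson R := by
  refine mem_jacobson_of_forall_spectrum_subset_zero ?_
  rintro ⟨y, hy⟩
  -- A spectrum with connected complement is the same in a closed subalgebra as in `A`.
  have hconn : IsPreconnected (spectrum ℂ (y * x))ᶜ := by
    rcases Set.subset_singleton_iff_eq.1 (h y hy) with h | h
    · rw [h, Set.compl_empty]; exact isPreconnected_univ
    · rw [h]; exact (isConnected_compl_singleton_of_one_lt_rank (by simp) 0).isPreconnected
  have e := Subalgebra.spectrum_eq_of_isPreconnected_compl R ((⟨y, hy⟩ : R) * ⟨x, hx⟩) hconn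
  rw [e]
  exact h y hy

/-! ### The hyperalgebra of a band and its closure -/

section Hyperalgebra

variable {X : Type*} [NormedAddCommGroup X] [NormedSpace ℂ X] {S : Set (X →L[ℂ] X)}

theorem IsOperatorBand.mul_self_of_mem_closure (hS : IsOperatorBand S) {x : X →L[ℂ] X}
    (hx : x ∈ Submonoid.closure S) : x * x = x := by
  have : x = 1 ∨ x ∈ S := by
    induction hx using Submonoid.closure_induction with
    | mem x hx => exact .inr hx
    | one => exact .inl rfl
    | mul x y _ _ hx hy =>
      rcases hx with rfl | hx
      · rwa [one_mul]
      · rcases hy with rfl | hy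
        · rw [mul_one]; exact .inr hx
        · exact .inr (hS.mul_mem hx hy)
  rcases this with rfl | h
  · exact one_mul 1
  · exact hS.idempotent h

/-- In the hyperalgebra itself, the products of elements with commutators with elements of the
algebra generated by the band are quasinilpotent. -/
theorem IsOperatorBand.spectrum_mul_commutator_subset (hS : IsOperatorBand S)
    {K A B : X →L[ℂ] X} (hK : K ∈ generatedAlgebra S) (hA : A ∈ hyperalgebra S)
    (hB : B ∈ hyperalgebra S) : spectrum ℂ (B * (K * A - A * K)) ⊆ {0} := by
  obtain ⟨F₁, hF₁, hf₁, hK'⟩ := exists_finite_mem_nonUnital_adjoin hK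
  obtain ⟨F₂, hF₂, hf₂, hA'⟩ := exists_finite_mem_adjoin_union hA
  obtain ⟨F₃, hF₃, hf₃, hB'⟩ := exists_finite_mem_adjoin_union hB
  -- One finite set serves all three operators; shrinking `S` to `G` only enlarges the commutant.
  let G := F₁ ∪ F₂ ∪ F₃
  have hGS : G ⊆ S := Set.union_subset (Set.union_subset hF₁ hF₂) hF₃
  have hG : G.Finite := (hf₁.union hf₂).union hf₃
  have hA'' : A ∈ Algebra.adjoin ℂ (G ∪ Set.centralizer S) :=
    Algebra.adjoin_mono (Set.union_subset_union_left _
      (Set.subset_union_right.trans Set.subset_union_left)) hA'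
  have hB'' : B ∈ Algebra.adjoin ℂ (G ∪ Set.centralizer S) :=
    Algebra.adjoin_mono (Set.union_subset_union_left _ Set.subset_union_right) hB'
  have hKG : K ∈ NonUnitalAlgebra.adjoin ℂ G := NonUnitalAlgebra.adjoin_mono
    (Set.subset_union_left.trans Set.subset_union_left) hK'
  exact spectrum_mul_commutator_subset_zero hG (Set.centralizer_subset hGS)
    (fun x hx => hS.mul_self_of_mem_closure (Submonoid.closure_mono hGS hx)) hKG hA'' hB''

end Hyperalgebra

theorem proposition4p2 {X : Type*} [NormedAddCommGroup X] [NormedSpace ℂ X] [CompleteSpace X]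
    (S : Set (X →L[ℂ] X)) (hS : IsOperatorBand S) (hS0 : S ≠ {0})
    (K : X →L[ℂ] X) (hK : K ∈ (generatedAlgebra S).topologicalClosure)
    (hKc : IsCompactOperator K)
    (A : X →L[ℂ] X) (hA : A ∈ (hyperalgebra S).topologicalClosure) :
    ∃ h : ⁅K, A⁆ ∈ (hyperalgebra S).topologicalClosure,
      (⟨⁅K, A⁆, h⟩ : (hyperalgebra S).topologicalClosure) ∈
        Ring.jacobson (hyperalgebra S).topologicalClosure := by
  have hle : ∀ T ∈ generatedAlgebra S, T ∈ hyperalgebra S := fun T hT =>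
    nonUnital_adjoin_subset_adjoin_union hT
  have hKH : K ∈ (hyperalgebra S).topologicalClosure :=
    closure_mono (s := (generatedAlgebra S : Set (X →L[ℂ] X))) hle hK
  have hmem : ⁅K, A⁆ ∈ (hyperalgebra S).topologicalClosure := by
    rw [Ring.lie_def]
    exact sub_mem (mul_mem hKH hA) (mul_mem hA hKH)
  refine ⟨hmem, mem_jacobson_of_isClosed (Subalgebra.isClosed_topologicalClosure _) hmem ?_⟩
  intro B hB
  rw [Ring.lie_def]
  obtain ⟨k, hk, hkK⟩ := mem_closure_iff_seq_limit.1 hK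
  obtain ⟨a, ha, haA⟩ := mem_closure_iff_seq_limit.1 hA
  obtain ⟨b, hb, hbB⟩ := mem_closure_iff_seq_limit.1 hB
  have hc : IsCompactOperator (B * (K * A - A * K) : X →L[ℂ] X) :=
    IsCompactOperator.clm_comp (f := (K * A - A * K : X →L[ℂ] X))
      ((hKc.comp_clm A).sub (hKc.clm_comp A)) B
  exact hc.spectrum_subset_zero_of_tendsto
    (fun n => hS.spectrum_mul_commutator_subset (hk n) (ha n) (hb n))
    (hbB.mul ((hkK.mul haA).sub (haA.mul hkK)))
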